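/- Let $k$ be a field of characteristic $p\ge 3$. Let $k[Y]$ be the polynomial Hopf algebra with $Y$ primitive, and let $H_4$ be Sweedler's Hopf algebra over $k$, with basis $1,g,x,gx$, relations $g^2=1$, $x^2=0$, $xg=-gx$, with $g$ group-like and $\Delta(x)=x\otimes 1+g\otimes x$. For $j\ge 0$ let $A_{(e_j)}$ be the Hopf algebra over $k$ generated as an algebra by $Y,g,x$ subject to the relations $$g^2=1,\qquad x^2=Y^{p^j},\qquad xg=-gx,\qquad gY=Yg,\qquad xY=Yx,$$ with $Y$ primitive, $g$ group-like and $\Delta(x)=x\otimes 1+g\otimes x$. For Hopf algebras $A$ and $H$, a crossed product $A\# H$ is given by a linear map $\triangleright:H\otimes A\to A$ with $h\triangleright 1=\varepsilon(h)1$, $1\triangleright a=a$, $h\triangleright(ab)=(h_{(1)}\triangleright a)(h_{(2)}\triangleright b)$, and a linear map $f:H\otimes H\to A$, such that $A\otimes H$ with the multiplication $(a\#h)(c\#g)=a\,(h_{(1)}\triangleright c)\,f(h_{(2)},g_{(1)})\,\#\,h_{(3)}g_{(2)}$, the unit $1\#1$ and the tensor product coalgebra structure is a Hopf algebra. Let $\mathrm{Crp}(H,A)$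 be the set of Hopf algebra isomorphism types of all crossed products $A\# H$. Then the Hopf algebras $A_{(e_j)}$, $j\ge 0$, are pairwise non-isomorphic, and each of them is isomorphic to a crossed product $k[Y]\# H_4$. In particular, $\mathrm{Crp}(H_4,k[Y])$ is an infinite set. -/

import Mathlib

open scoped TensorProduct Polynomial Quaternion

noncomputable section

/-! ### Constructing antipodes -/

section AntipodeTools

variable {k A : Type*} [Field k] [Ring A] [Bialgebra k A]

theorem mul'_rTensor_antipode_mul (S : A →ₐ[k] Aᵐᵒᵖ) (u v : A ⊗[k] A) (c : k)
    (hu : LinearMap.mul' k A (((MulOpposite.opLinearEquiv k).symm.toLinearMap ∘ₗ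
      S.toLinearMap).rTensor A u) = algebraMap k A c) :
    LinearMap.mul' k A (((MulOpposite.opLinearEquiv k).symm.toLinearMap ∘ₗ
      S.toLinearMap).rTensor A (u * v)) =
    c • LinearMap.mul' k A (((MulOpposite.opLinearEquiv k).symm.toLinearMap ∘ₗ
      S.toLinearMap).rTensor A v) := by
  induction v using TensorProduct.induction_on with
  | zero => simp
  | add x y hx hy => simp only [mul_add, map_add, hx, hy, smul_add]
  | tmul b₁ b₂ =>
    have key : ∀ u : A ⊗[k] A,
        LinearMap.mul' k A (((MulOpposite.opLinearEquiv k).symm.toLinearMap ∘ₗ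
          S.toLinearMap).rTensor A (u * (b₁ ⊗ₜ[k] b₂))) =
        (S b₁).unop * LinearMap.mul' k A (((MulOpposite.opLinearEquiv k).symm.toLinearMap ∘ₗ
          S.toLinearMap).rTensor A u) * b₂ := by
      intro u
      induction u using TensorProduct.induction_on with
      | zero => simp
      | add x y hx hy => simp only [add_mul, mul_add, map_add, hx, hy]
      | tmul a₁ a₂ => simp [mul_assoc]
    rw [key, hu, Algebra.algebraMap_eq_smul_one]
    simp

theorem mul'_lTensor_antipode_mul (S : A →ₐ[k] Aᵐᵒᵖ) (u v : A ⊗[k] A) (c : k)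
    (hv : LinearMap.mul' k A (((MulOpposite.opLinearEquiv k).symm.toLinearMap ∘ₗ
      S.toLinearMap).lTensor A v) = algebraMap k A c) :
    LinearMap.mul' k A (((MulOpposite.opLinearEquiv k).symm.toLinearMap ∘ₗ
      S.toLinearMap).lTensor A (u * v)) =
    c • LinearMap.mul' k A (((MulOpposite.opLinearEquiv k).symm.toLinearMap ∘ₗ
      S.toLinearMap).lTensor A u) := by
  induction u using TensorProduct.induction_on with
  | zero => simp
  | add x y hx hy => simp only [add_mul, map_add, hx, hy, smul_add]
  | tmul a₁ a₂ =>
    have key : ∀ v : A ⊗[k] A,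
        LinearMap.mul' k A (((MulOpposite.opLinearEquiv k).symm.toLinearMap ∘ₗ
          S.toLinearMap).lTensor A ((a₁ ⊗ₜ[k] a₂) * v)) =
        a₁ * LinearMap.mul' k A (((MulOpposite.opLinearEquiv k).symm.toLinearMap ∘ₗ
          S.toLinearMap).lTensor A v) * (S a₂).unop := by
      intro v
      induction v using TensorProduct.induction_on with
      | zero => simp
      | add x y hx hy => simp only [add_mul, mul_add, map_add, hx, hy]
      | tmul b₁ b₂ => simp [mul_assoc]
    rw [key, hv, Algebra.algebraMap_eq_smul_one]
    simp

end AntipodeTools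

/-! ### The polynomial Hopf algebra `k[Y]`, with `Y` primitive -/

section PolynomialHopf

variable (k : Type*) [Field k]

/-- The bialgebra `k[Y]` with `Δ(Y) = Y ⊗ 1 + 1 ⊗ Y` and `ε(Y) = 0`. -/
instance polynomialPrimitiveBialgebra : Bialgebra k k[X] :=
  Bialgebra.ofAlgHom
    (Polynomial.aeval (Polynomial.X ⊗ₜ[k] 1 + 1 ⊗ₜ[k] Polynomial.X))
    (Polynomial.aeval 0)
    (by ext; simp [Algebra.TensorProduct.one_def, TensorProduct.add_tmul,
          TensorProduct.tmul_add, add_assoc])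
    (by ext; simp)
    (by ext; simp)

@[simp] theorem polynomial_comul_X : Coalgebra.comul (R := k) (Polynomial.X : k[X]) =
    Polynomial.X ⊗ₜ[k] 1 + 1 ⊗ₜ[k] Polynomial.X :=
  Polynomial.aeval_X _

@[simp] theorem polynomial_counit_X : Coalgebra.counit (R := k) (Polynomial.X : k[X]) = 0 :=
  Polynomial.aeval_X _

/-- The Hopf algebra `k[Y]` with `Y` primitive; the antipode sends `Y` to `-Y`. -/
instance polynomialPrimitiveHopfAlgebra : HopfAlgebra k k[X] :=
  HopfAlgebra.ofAlgHom (Polynomial.aeval (-Polynomial.X))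
    (by
      apply Polynomial.algHom_ext
      simp only [AlgHom.comp_apply, Bialgebra.comulAlgHom_apply, polynomial_comul_X,
        Bialgebra.counitAlgHom_apply, polynomial_counit_X, map_add, map_zero]
      erw [Algebra.TensorProduct.lift_tmul, Algebra.TensorProduct.lift_tmul]
      simp)
    (by
      apply Polynomial.algHom_ext
      simp only [AlgHom.comp_apply, Bialgebra.comulAlgHom_apply, polynomial_comul_X,
        Bialgebra.counitAlgHom_apply, polynomial_counit_X, map_add, map_zero]
      rw [Algebra.TensorProduct.lift_tmul, Algebra.TensorProduct.lift_tmul]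
      simp)

end PolynomialHopf

/-! ### Sweedler's four-dimensional Hopf algebra -/

/-- The algebra with `k`-basis `1, g, x, gx` and `g² = 1`, `x² = 0`, `xg = -gx`. It is the
degenerate quaternion algebra with `i² = 1`, `j² = 0`, `ji = -ij`, where `g = i`, `x = j` and
`gx = ij`. -/
abbrev SweedlerH4 (k : Type*) [Field k] : Type _ := ℍ[k, 1, 0, 0]

namespace SweedlerH4

variable (k : Type*) [Field k]

def g : SweedlerH4 k := ⟨0, 1, 0, 0⟩

def x : SweedlerH4 k := ⟨0, 0, 1, 0⟩

theorem g_mul_g : g k * g k = 1 := by ext <;> simp [g]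

theorem x_mul_x : x k * x k = 0 := by ext <;> simp [x]

theorem x_mul_g : x k * g k = -(g k * x k) := by ext <;> simp [g, x]

theorem g_mul_x : g k * x k = ⟨0, 0, 0, 1⟩ := by ext <;> simp [g, x]

theorem eq_smul (a : SweedlerH4 k) :
    a = a.re • 1 + a.imI • g k + a.imJ • x k + a.imK • (g k * x k) := by
  ext <;> simp [g, x]

/-- The comultiplication: `g` is group-like and `x` is `(1, g)`-primitive. -/
def comulHom : SweedlerH4 k →ₐ[k] SweedlerH4 k ⊗[k] SweedlerH4 k :=
  QuaternionAlgebra.lift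
    { i := g k ⊗ₜ[k] g k
      j := x k ⊗ₜ[k] 1 + g k ⊗ₜ[k] x k
      k := (g k ⊗ₜ[k] g k) * (x k ⊗ₜ[k] 1 + g k ⊗ₜ[k] x k)
      i_mul_i := by simp [g_mul_g, Algebra.TensorProduct.one_def]
      j_mul_j := by
        simp [mul_add, add_mul, g_mul_g, x_mul_x, x_mul_g, TensorProduct.neg_tmul]
      i_mul_j := rfl
      j_mul_i := by
        simp [mul_add, add_mul, g_mul_g, x_mul_g, TensorProduct.neg_tmul,
          TensorProduct.tmul_neg]
        abel }

/-- The counit: `ε(g) = 1`, `ε(x) = 0`. -/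
def counitHom : SweedlerH4 k →ₐ[k] k :=
  QuaternionAlgebra.lift
    { i := 1
      j := 0
      k := 0
      i_mul_i := by simp
      j_mul_j := by simp
      i_mul_j := by simp
      j_mul_i := by simp }

theorem comulHom_g : comulHom k (g k) = g k ⊗ₜ[k] g k := by
  simp [comulHom, QuaternionAlgebra.Basis.lift, g]

theorem comulHom_x : comulHom k (x k) = x k ⊗ₜ[k] 1 + g k ⊗ₜ[k] x k := by
  simp [comulHom, QuaternionAlgebra.Basis.lift, x]

theorem counitHom_g : counitHom k (g k) = 1 := by
  simp [counitHom, QuaternionAlgebra.Basis.lift, g]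

theorem counitHom_x : counitHom k (x k) = 0 := by
  simp [counitHom, QuaternionAlgebra.Basis.lift, x]

theorem algHom_ext {k : Type*} [Field k] {B : Type*} [Ring B] [Algebra k B]
    {φ ψ : SweedlerH4 k →ₐ[k] B}
    (hg : φ (g k) = ψ (g k)) (hx : φ (x k) = ψ (x k)) : φ = ψ :=
  QuaternionAlgebra.hom_ext hg hx

instance bialgebra : Bialgebra k (SweedlerH4 k) :=
  Bialgebra.ofAlgHom (comulHom k) (counitHom k)
    (by
      apply algHom_ext
      · simp [comulHom_g]
      · simp [comulHom_g, comulHom_x, Algebra.TensorProduct.one_def, TensorProduct.add_tmul,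
          TensorProduct.tmul_add, add_assoc])
    (by
      apply algHom_ext
      · simp [comulHom_g, counitHom_g]
      · simp [comulHom_x, counitHom_g, counitHom_x])
    (by
      apply algHom_ext
      · simp [comulHom_g, counitHom_g]
      · simp [comulHom_x, counitHom_x])

@[simp] theorem comul_g : Coalgebra.comul (R := k) (g k) = g k ⊗ₜ[k] g k := comulHom_g k

@[simp] theorem comul_x :
    Coalgebra.comul (R := k) (x k) = x k ⊗ₜ[k] 1 + g k ⊗ₜ[k] x k := comulHom_x k

@[simp] theorem counit_g : Coalgebra.counit (R := k) (g k) = 1 := counitHom_g k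

@[simp] theorem counit_x : Coalgebra.counit (R := k) (x k) = 0 := counitHom_x k

/-- The antipode: `S(1) = 1`, `S(g) = g`, `S(x) = -gx`, `S(gx) = x`. -/
def antipodeMap : SweedlerH4 k →ₗ[k] SweedlerH4 k where
  toFun a := ⟨a.re, a.imI, a.imK, -a.imJ⟩
  map_add' a b := by ext <;> simp; ring
  map_smul' c a := by ext <;> simp

instance hopfAlgebra : HopfAlgebra k (SweedlerH4 k) where
  antipode := antipodeMap k
  mul_antipode_rTensor_comul := by
    ext a
    all_goals
      rw [eq_smul k a]
      simp [Algebra.TensorProduct.one_def, mul_add, Algebra.algebraMap_eq_smul_one]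
      simp [antipodeMap, g, x]
  mul_antipode_lTensor_comul := by
    ext a
    all_goals
      rw [eq_smul k a]
      simp [Algebra.TensorProduct.one_def, mul_add, Algebra.algebraMap_eq_smul_one]
      simp [antipodeMap, g, x]

end SweedlerH4

/-! ### Crossed products of Hopf algebras -/

section CrossedProducts

section Multiplication

variable {k A H : Type*} [Field k] [Ring A] [HopfAlgebra k A] [Ring H] [HopfAlgebra k H]

variable (k A H) in
/-- `a ⊗ (b ⊗ h) ↦ ab ⊗ h`. -/
def crossedLeftMul : A ⊗[k] (A ⊗[k] H) →ₗ[k] A ⊗[k] H :=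
  (LinearMap.mul' k A).rTensor H ∘ₗ (TensorProduct.assoc k A A H).symm.toLinearMap

/-- `h ⊗ g ↦ f(h₁, g₁) ⊗ h₂ g₂`. -/
def crossedCocycleMul (f : H →ₗ[k] H →ₗ[k] A) : H ⊗[k] H →ₗ[k] A ⊗[k] H :=
  TensorProduct.map (TensorProduct.lift f) (LinearMap.mul' k H) ∘ₗ Coalgebra.comul

/-- `h ⊗ (c ⊗ g) ↦ (h₁ ▷ c) f(h₂, g₁) ⊗ h₃ g₂`. -/
def crossedActMul (act : H →ₗ[k] A →ₗ[k] A) (f : H →ₗ[k] H →ₗ[k] A) :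
    H ⊗[k] (A ⊗[k] H) →ₗ[k] A ⊗[k] H :=
  crossedLeftMul k A H ∘ₗ
    TensorProduct.map (TensorProduct.lift act) (crossedCocycleMul f) ∘ₗ
    (TensorProduct.tensorTensorTensorComm k H H A H).toLinearMap ∘ₗ
    Coalgebra.comul.rTensor (A ⊗[k] H)

/-- The multiplication `(a # h)(c # g) = a (h₁ ▷ c) f(h₂, g₁) # h₃ g₂` on `A ⊗ H`. -/
def crossedMul (act : H →ₗ[k] A →ₗ[k] A) (f : H →ₗ[k] H →ₗ[k] A) :
    A ⊗[k] H →ₗ[k] A ⊗[k] H →ₗ[k] A ⊗[k] H :=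
  TensorProduct.curry (crossedLeftMul k A H ∘ₗ (crossedActMul act f).lTensor A ∘ₗ
    (TensorProduct.assoc k A H (A ⊗[k] H)).toLinearMap)

/-- The multiplication in Sweedler notation: if `Δ(h) = ∑ᵢ hᵢ' ⊗ hᵢ''`,
`Δ(hᵢ'') = ∑ⱼ uᵢⱼ ⊗ vᵢⱼ` and `Δ(g) = ∑ₗ gₗ' ⊗ gₗ''`, then
`(a # h)(c # g) = ∑ᵢⱼₗ a (hᵢ' ▷ c) f(uᵢⱼ, gₗ') # vᵢⱼ gₗ''`. -/
theorem crossedMul_tmul_tmul (act : H →ₗ[k] A →ₗ[k] A) (f : H →ₗ[k] H →ₗ[k] A)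
    (a c : A) (h g : H) {ι κ : Type*} {τ : ι → Type*} (r : Coalgebra.Repr k h ι)
    (s : ∀ i, Coalgebra.Repr k (r.right i) (τ i)) (t : Coalgebra.Repr k g κ) :
    crossedMul act f (a ⊗ₜ[k] h) (c ⊗ₜ[k] g) =
      ∑ i ∈ r.index, ∑ j ∈ (s i).index, ∑ l ∈ t.index,
        (a * act (r.left i) c * f ((s i).left j) (t.left l)) ⊗ₜ[k]
          ((s i).right j * t.right l) := by
  have hT : ∀ i, crossedCocycleMul f (r.right i ⊗ₜ[k] g) =
      ∑ j ∈ (s i).index, ∑ l ∈ t.index,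
        f ((s i).left j) (t.left l) ⊗ₜ[k] ((s i).right j * t.right l) := by
    intro i
    simp only [crossedCocycleMul, LinearMap.comp_apply, TensorProduct.comul_tmul, ← (s i).eq,
      ← t.eq, TensorProduct.sum_tmul, TensorProduct.tmul_sum, map_sum]
    rw [Finset.sum_comm]
    simp
  simp only [crossedMul, TensorProduct.curry_apply, LinearMap.comp_apply, crossedActMul,
    LinearEquiv.coe_coe, TensorProduct.assoc_tmul, LinearMap.lTensor_tmul,
    LinearMap.rTensor_tmul, ← r.eq, TensorProduct.sum_tmul, TensorProduct.tmul_sum, map_sum,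
    TensorProduct.tensorTensorTensorComm_tmul, TensorProduct.map_tmul, hT]
  simp [crossedLeftMul, mul_assoc]

end Multiplication

variable (k A H : Type*) [Field k] [Ring A] [HopfAlgebra k A] [Ring H] [HopfAlgebra k H]

/-- A crossed system of Hopf algebras `(A, H, ▷, f)`: a weak action `▷` of `H` on `A` and a linear
map `f : H ⊗ H → A` such that `A ⊗ H`, with the multiplication
`(a # h)(c # g) = a (h₁ ▷ c) f(h₂, g₁) # h₃ g₂`, the unit `1 # 1` and the coalgebra structure of
the tensor product of coalgebras, is a Hopf algebra. -/
@[ext]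
structure CrossedSystem where
  /-- the weak action `h ▷ a` -/
  act : H →ₗ[k] A →ₗ[k] A
  /-- the map `f(h, g)` -/
  cocycle : H →ₗ[k] H →ₗ[k] A
  act_one : ∀ h : H, act h 1 = (Coalgebra.counit (R := k) h) • (1 : A)
  one_act : ∀ a : A, act 1 a = a
  /-- `h ▷ (ab) = (h₁ ▷ a)(h₂ ▷ b)` -/
  act_mul : ∀ (h : H) (a b : A), act h (a * b) =
    LinearMap.mul' k A (TensorProduct.map (act.flip a) (act.flip b) (Coalgebra.comul h))
  mul_assoc : ∀ u v w : A ⊗[k] H, crossedMul act cocycle (crossedMul act cocycle u v) w =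
    crossedMul act cocycle u (crossedMul act cocycle v w)
  one_mul : ∀ u : A ⊗[k] H, crossedMul act cocycle (1 ⊗ₜ[k] 1) u = u
  mul_one : ∀ u : A ⊗[k] H, crossedMul act cocycle u (1 ⊗ₜ[k] 1) = u
  counit_mul : ∀ u v : A ⊗[k] H, Coalgebra.counit (R := k) (crossedMul act cocycle u v) =
    Coalgebra.counit (R := k) u * Coalgebra.counit (R := k) v
  /-- `Δ(uv) = u₁ v₁ ⊗ u₂ v₂` -/
  comul_mul : ∀ u v : A ⊗[k] H, Coalgebra.comul (R := k) (crossedMul act cocycle u v) =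
    TensorProduct.map₂ (crossedMul act cocycle) (crossedMul act cocycle)
      (Coalgebra.comul (R := k) u) (Coalgebra.comul (R := k) v)
  /-- there is an antipode -/
  exists_antipode : ∃ S : A ⊗[k] H →ₗ[k] A ⊗[k] H, ∀ u : A ⊗[k] H,
    TensorProduct.lift (crossedMul act cocycle) (S.rTensor _ (Coalgebra.comul (R := k) u)) =
      (Coalgebra.counit (R := k) u) • ((1 : A) ⊗ₜ[k] (1 : H)) ∧
    TensorProduct.lift (crossedMul act cocycle) (S.lTensor _ (Coalgebra.comul (R := k) u)) =
      (Coalgebra.counit (R := k) u) • ((1 : A) ⊗ₜ[k] (1 : H))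

variable {k A H}

/-- The crossed product of Hopf algebras `A # H` of a crossed system: the vector space `A ⊗ H`. -/
def CrossedProduct (_S : CrossedSystem k A H) : Type _ := A ⊗[k] H

namespace CrossedProduct

variable (S : CrossedSystem k A H)

instance : AddCommGroup (CrossedProduct S) := inferInstanceAs (AddCommGroup (A ⊗[k] H))

instance : Module k (CrossedProduct S) := inferInstanceAs (Module k (A ⊗[k] H))

instance : Coalgebra k (CrossedProduct S) := inferInstanceAs (Coalgebra k (A ⊗[k] H))

instance : Ring (CrossedProduct S) :=
  { (inferInstance : AddCommGroup (CrossedProduct S)) with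
    mul := fun u v => crossedMul S.act S.cocycle u v
    one := (1 : A) ⊗ₜ[k] (1 : H)
    mul_assoc := S.mul_assoc
    one_mul := S.one_mul
    mul_one := S.mul_one
    left_distrib := fun u v w => map_add (crossedMul S.act S.cocycle u) v w
    right_distrib := fun u v w => LinearMap.map_add₂ (crossedMul S.act S.cocycle) u v w
    zero_mul := fun u => LinearMap.map_zero₂ (crossedMul S.act S.cocycle) u
    mul_zero := fun u => map_zero (crossedMul S.act S.cocycle u) }

instance : Algebra k (CrossedProduct S) :=
  Algebra.ofModule
    (fun c u v => LinearMap.map_smul₂ (crossedMul S.act S.cocycle) c u v)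
    (fun c u v => map_smul (crossedMul S.act S.cocycle u) c v)

theorem mul_def (u v : CrossedProduct S) : u * v = crossedMul S.act S.cocycle u v := rfl

theorem one_def : (1 : CrossedProduct S) = (1 : A) ⊗ₜ[k] (1 : H) := rfl

theorem counit_one' : Coalgebra.counit (R := k) (1 : CrossedProduct S) = 1 := by
  have h : Coalgebra.counit (R := k) ((1 : A) ⊗ₜ[k] (1 : H)) = 1 := by simp
  exact h

theorem comul_one' : Coalgebra.comul (R := k) (1 : CrossedProduct S) = 1 := by
  have h : Coalgebra.comul (R := k) ((1 : A) ⊗ₜ[k] (1 : H)) =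
      ((1 : A) ⊗ₜ[k] (1 : H)) ⊗ₜ[k] ((1 : A) ⊗ₜ[k] (1 : H)) := by
    simp [Algebra.TensorProduct.one_def]
  exact h

theorem map₂_eq_mul (P Q : CrossedProduct S ⊗[k] CrossedProduct S) :
    TensorProduct.map₂ (LinearMap.mul k (CrossedProduct S))
      (LinearMap.mul k (CrossedProduct S)) P Q = P * Q := by
  induction P using TensorProduct.induction_on with
  | zero => simp
  | add x y hx hy => simp only [map_add, add_mul, LinearMap.add_apply, hx, hy]
  | tmul a b =>
    induction Q using TensorProduct.induction_on with
    | zero => simp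
    | add x y hx hy => simp only [map_add, mul_add, hx, hy]
    | tmul c d => simp

theorem comul_mul' (u v : CrossedProduct S) : Coalgebra.comul (R := k) (u * v) =
    Coalgebra.comul (R := k) u * Coalgebra.comul (R := k) v :=
  (S.comul_mul u v).trans (map₂_eq_mul S (Coalgebra.comul u) (Coalgebra.comul v))

instance : Bialgebra k (CrossedProduct S) :=
  Bialgebra.mk' k (CrossedProduct S) (counit_one' S) (S.counit_mul _ _) (comul_one' S)
    (comul_mul' S _ _)

instance : HopfAlgebra k (CrossedProduct S) where
  antipode := S.exists_antipode.choose
  mul_antipode_rTensor_comul := LinearMap.ext fun u =>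
    ((S.exists_antipode.choose_spec u).1).trans
      (Algebra.algebraMap_eq_smul_one (A := CrossedProduct S) _).symm
  mul_antipode_lTensor_comul := LinearMap.ext fun u =>
    ((S.exists_antipode.choose_spec u).2).trans
      (Algebra.algebraMap_eq_smul_one (A := CrossedProduct S) _).symm

end CrossedProduct

variable (k H A) in
/-- Two crossed systems are identified when their crossed products are isomorphic as Hopf
algebras. (A bialgebra isomorphism of Hopf algebras commutes with the antipodes.) -/
def crpSetoid : Setoid (CrossedSystem k A H) where
  r S T := Nonempty (CrossedProduct S ≃ₐc[k] CrossedProduct T)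
  iseqv :=
    { refl := fun _ => ⟨BialgEquiv.refl k _⟩
      symm := fun ⟨e⟩ => ⟨e.symm⟩
      trans := fun ⟨e⟩ ⟨e'⟩ => ⟨e.trans e'⟩ }

variable (k H A) in
/-- The set `Crp(H, A)` of isomorphism types of Hopf algebras of all crossed products `A # H`. -/
def Crp : Type _ := Quotient (crpSetoid k H A)

end CrossedProducts

/-! ### The Hopf algebras `A_(α)` -/

/-- The generators `Y`, `g`, `x`. -/
inductive QuantumGen : Type
  | Y
  | g
  | x

section Relations

variable (k : Type*) [Field k] (p : ℕ) (α : ℕ →₀ k)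

/-- The defining relations `g² = 1`, `x² = ∑ᵢ αᵢ Y^(pⁱ)`, `xg = -gx`, `gY = Yg`, `xY = Yx`. -/
inductive QuantumRel : FreeAlgebra k QuantumGen → FreeAlgebra k QuantumGen → Prop
  | g_sq : QuantumRel (FreeAlgebra.ι k .g * FreeAlgebra.ι k .g) 1
  | x_sq : QuantumRel (FreeAlgebra.ι k .x * FreeAlgebra.ι k .x)
      (α.sum fun i c => c • FreeAlgebra.ι k .Y ^ p ^ i)
  | x_mul_g : QuantumRel (FreeAlgebra.ι k .x * FreeAlgebra.ι k .g)
      (-(FreeAlgebra.ι k .g * FreeAlgebra.ι k .x))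
  | g_mul_Y : QuantumRel (FreeAlgebra.ι k .g * FreeAlgebra.ι k .Y)
      (FreeAlgebra.ι k .Y * FreeAlgebra.ι k .g)
  | x_mul_Y : QuantumRel (FreeAlgebra.ι k .x * FreeAlgebra.ι k .Y)
      (FreeAlgebra.ι k .Y * FreeAlgebra.ι k .x)

/-- The algebra `A_(α)` generated by `Y`, `g`, `x` subject to the relations `g² = 1`,
`x² = ∑ᵢ αᵢ Y^(pⁱ)`, `xg = -gx`, `gY = Yg`, `xY = Yx`. -/
def QuantumAlg : Type _ := RingQuot (QuantumRel k p α)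

end Relations

namespace QuantumAlg

variable (k : Type*) [Field k] (p : ℕ) (α : ℕ →₀ k)

instance : Ring (QuantumAlg k p α) := inferInstanceAs (Ring (RingQuot (QuantumRel k p α)))

instance : Algebra k (QuantumAlg k p α) :=
  inferInstanceAs (Algebra k (RingQuot (QuantumRel k p α)))

/-- The image of a generator. -/
def gen (t : QuantumGen) : QuantumAlg k p α :=
  RingQuot.mkAlgHom k (QuantumRel k p α) (FreeAlgebra.ι k t)

def Y : QuantumAlg k p α := gen k p α .Y

def g : QuantumAlg k p α := gen k p α .g

def x : QuantumAlg k p α := gen k p α .x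

theorem g_mul_g : g k p α * g k p α = 1 := by
  have h := RingQuot.mkAlgHom_rel k (QuantumRel.g_sq (k := k) (p := p) (α := α))
  rwa [map_mul, map_one] at h

theorem x_mul_x : x k p α * x k p α = α.sum fun i c => c • Y k p α ^ p ^ i := by
  have h := RingQuot.mkAlgHom_rel k (QuantumRel.x_sq (k := k) (p := p) (α := α))
  rw [map_mul, map_finsuppSum] at h
  simp only [map_smul, map_pow] at h
  exact h

theorem x_mul_g : x k p α * g k p α = -(g k p α * x k p α) := by
  have h := RingQuot.mkAlgHom_rel k (QuantumRel.x_mul_g (k := k) (p := p) (α := α))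
  rwa [map_mul, map_neg, map_mul] at h

theorem g_mul_Y : g k p α * Y k p α = Y k p α * g k p α := by
  have h := RingQuot.mkAlgHom_rel k (QuantumRel.g_mul_Y (k := k) (p := p) (α := α))
  rwa [map_mul, map_mul] at h

theorem x_mul_Y : x k p α * Y k p α = Y k p α * x k p α := by
  have h := RingQuot.mkAlgHom_rel k (QuantumRel.x_mul_Y (k := k) (p := p) (α := α))
  rwa [map_mul, map_mul] at h

section Lift

variable {k p α} {B : Type*} [Ring B] [Algebra k B]

/-- The algebra map out of `A_(α)` given by images of `Y`, `g`, `x` satisfying the relations. -/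
def lift (y g x : B) (hg : g * g = 1) (hx : x * x = α.sum fun i c => c • y ^ p ^ i)
    (hxg : x * g = -(g * x)) (hgy : g * y = y * g) (hxy : x * y = y * x) :
    QuantumAlg k p α →ₐ[k] B :=
  RingQuot.liftAlgHom k ⟨FreeAlgebra.lift k (fun t : QuantumGen => match t with
    | .Y => y
    | .g => g
    | .x => x), by
    intro u v h
    cases h with
    | g_sq => simpa using hg
    | x_sq => rw [map_finsuppSum]; simpa using hx
    | x_mul_g => simpa using hxg
    | g_mul_Y => simpa using hgy
    | x_mul_Y => simpa using hxy⟩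

variable (y g' x' : B) (hg : g' * g' = 1) (hx : x' * x' = α.sum fun i c => c • y ^ p ^ i)
    (hxg : x' * g' = -(g' * x')) (hgy : g' * y = y * g') (hxy : x' * y = y * x')

@[simp] theorem lift_Y : lift y g' x' hg hx hxg hgy hxy (Y k p α) = y := by
  simp only [lift, Y, gen]
  erw [RingQuot.liftAlgHom_mkAlgHom_apply]
  simp

@[simp] theorem lift_g : lift y g' x' hg hx hxg hgy hxy (g k p α) = g' := by
  simp only [lift, g, gen]
  erw [RingQuot.liftAlgHom_mkAlgHom_apply]
  simp

@[simp] theorem lift_x : lift y g' x' hg hx hxg hgy hxy (x k p α) = x' := by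
  simp only [lift, x, gen]
  erw [RingQuot.liftAlgHom_mkAlgHom_apply]
  simp

theorem algHom_ext {φ ψ : QuantumAlg k p α →ₐ[k] B} (hY : φ (Y k p α) = ψ (Y k p α))
    (hg : φ (QuantumAlg.g k p α) = ψ (QuantumAlg.g k p α))
    (hx : φ (QuantumAlg.x k p α) = ψ (QuantumAlg.x k p α)) : φ = ψ := by
  apply RingQuot.ringQuot_ext' k
  apply FreeAlgebra.hom_ext
  funext t
  cases t with
  | Y => exact hY
  | g => exact hg
  | x => exact hx

end Lift

theorem induction {motive : QuantumAlg k p α → Prop}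
    (algebraMap : ∀ c : k, motive (algebraMap k (QuantumAlg k p α) c))
    (Y : motive (Y k p α)) (g : motive (g k p α)) (x : motive (x k p α))
    (mul : ∀ a b, motive a → motive b → motive (a * b))
    (add : ∀ a b, motive a → motive b → motive (a + b)) (a : QuantumAlg k p α) : motive a := by
  obtain ⟨a, rfl⟩ := RingQuot.mkAlgHom_surjective k (QuantumRel k p α) a
  induction a using FreeAlgebra.induction with
  | grade0 c =>
    rw [AlgHom.commutes]
    exact algebraMap c
  | grade1 t =>
    cases t with
    | Y => exact Y
    | g => exact g
    | x => exact x
  | mul a b ha hb =>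
    rw [map_mul]
    exact mul _ _ ha hb
  | add a b ha hb =>
    rw [map_add]
    exact add _ _ ha hb

variable [hp : Fact p.Prime] [CharP k p]

theorem add_pow_prime_pow {B : Type*} [Ring B] [Algebra k B] {u v : B} (h : Commute u v) (n : ℕ) :
    (u + v) ^ p ^ n = u ^ p ^ n + v ^ p ^ n := by
  obtain ⟨r, hr⟩ := h.exists_add_pow_prime_pow_eq hp.out n
  have h0 : ((p : ℕ) : B) = 0 := by
    rw [← map_natCast (algebraMap k B), CharP.cast_eq_zero, map_zero]
  rw [hr, h0]
  simp

theorem neg_pow_prime_pow {B : Type*} [Ring B] [Algebra k B] (u : B) (n : ℕ) :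
    (-u) ^ p ^ n = -(u ^ p ^ n) := by
  have h := add_pow_prime_pow k p (Commute.neg_left (Commute.refl u)) n
  rw [neg_add_cancel, zero_pow (pow_ne_zero _ hp.out.ne_zero)] at h
  exact eq_neg_of_add_eq_zero_left h.symm

/-- The comultiplication: `Y` is primitive, `g` is group-like and `x` is `(1, g)`-primitive. -/
def comulHom : QuantumAlg k p α →ₐ[k] QuantumAlg k p α ⊗[k] QuantumAlg k p α :=
  lift (Y k p α ⊗ₜ[k] 1 + 1 ⊗ₜ[k] Y k p α) (g k p α ⊗ₜ[k] g k p α)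
    (x k p α ⊗ₜ[k] 1 + g k p α ⊗ₜ[k] x k p α)
    (by simp [g_mul_g, Algebra.TensorProduct.one_def])
    (by
      have hc : Commute (Y k p α ⊗ₜ[k] (1 : QuantumAlg k p α)) (1 ⊗ₜ[k] Y k p α) := by
        simp [Commute, SemiconjBy]
      simp only [add_pow_prime_pow k p hc]
      simp only [mul_add, add_mul, Algebra.TensorProduct.tmul_mul_tmul, x_mul_x, g_mul_g, x_mul_g,
        TensorProduct.neg_tmul, mul_one, one_mul, Algebra.TensorProduct.tmul_pow, one_pow,
        smul_add, Finsupp.sum, TensorProduct.sum_tmul, TensorProduct.tmul_sum,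
        TensorProduct.smul_tmul', TensorProduct.tmul_smul, Finset.sum_add_distrib]
      abel)
    (by
      simp [mul_add, add_mul, g_mul_g, x_mul_g, TensorProduct.neg_tmul, TensorProduct.tmul_neg]
      abel)
    (by simp [mul_add, add_mul, g_mul_Y])
    (by
      simp [mul_add, add_mul, g_mul_Y, x_mul_Y]
      abel)

/-- The counit: `ε(Y) = 0`, `ε(g) = 1`, `ε(x) = 0`. -/
def counitHom : QuantumAlg k p α →ₐ[k] k :=
  lift 0 1 0 (by simp)
    (by simp [Finsupp.sum, zero_pow (pow_ne_zero _ hp.out.ne_zero)])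
    (by simp) (by simp) (by simp)

instance bialgebra : Bialgebra k (QuantumAlg k p α) :=
  Bialgebra.ofAlgHom (comulHom k p α) (counitHom k p α)
    (by
      apply algHom_ext <;>
      simp [comulHom, Algebra.TensorProduct.one_def, TensorProduct.add_tmul,
          TensorProduct.tmul_add, add_assoc])
    (by apply algHom_ext <;> simp [comulHom, counitHom])
    (by apply algHom_ext <;> simp [comulHom, counitHom])

@[simp] theorem comul_Y : Coalgebra.comul (R := k) (Y k p α) =
    Y k p α ⊗ₜ[k] 1 + 1 ⊗ₜ[k] Y k p α := lift_Y _ _ _ _ _ _ _ _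

@[simp] theorem comul_g : Coalgebra.comul (R := k) (g k p α) = g k p α ⊗ₜ[k] g k p α :=
  lift_g _ _ _ _ _ _ _ _

@[simp] theorem comul_x : Coalgebra.comul (R := k) (x k p α) =
    x k p α ⊗ₜ[k] 1 + g k p α ⊗ₜ[k] x k p α := lift_x _ _ _ _ _ _ _ _

@[simp] theorem counit_Y : Coalgebra.counit (R := k) (Y k p α) = 0 := lift_Y _ _ _ _ _ _ _ _

@[simp] theorem counit_g : Coalgebra.counit (R := k) (g k p α) = 1 := lift_g _ _ _ _ _ _ _ _

@[simp] theorem counit_x : Coalgebra.counit (R := k) (x k p α) = 0 := lift_x _ _ _ _ _ _ _ _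

/-- The antipode as an algebra map to the opposite algebra: `S(Y) = -Y`, `S(g) = g`,
`S(x) = -gx`. -/
def antipodeHom : QuantumAlg k p α →ₐ[k] (QuantumAlg k p α)ᵐᵒᵖ :=
  lift (MulOpposite.op (-Y k p α)) (MulOpposite.op (g k p α))
    (MulOpposite.op (-(g k p α * x k p α)))
    (by rw [← MulOpposite.op_mul, g_mul_g, MulOpposite.op_one])
    (by
      have h : g k p α * x k p α * (g k p α * x k p α) = -(x k p α * x k p α) := by
        rw [mul_assoc, ← mul_assoc (x k p α), x_mul_g, neg_mul, mul_neg, ← mul_assoc,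
          ← mul_assoc, g_mul_g, one_mul]
      apply MulOpposite.unop_injective
      simp only [MulOpposite.unop_mul, MulOpposite.unop_op, neg_mul_neg, h, x_mul_x, Finsupp.sum,
        Finset.unop_sum, MulOpposite.unop_smul, MulOpposite.unop_pow, neg_pow_prime_pow k p,
        smul_neg, Finset.sum_neg_distrib])
    (by
      rw [← MulOpposite.op_mul, ← MulOpposite.op_mul, ← MulOpposite.op_neg]
      congr 1
      rw [mul_neg, neg_mul, neg_neg, ← mul_assoc, g_mul_g, mul_assoc, x_mul_g, mul_neg,
        ← mul_assoc, g_mul_g])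
    (by
      rw [← MulOpposite.op_mul, ← MulOpposite.op_mul]
      congr 1
      rw [mul_neg, neg_mul, g_mul_Y])
    (by
      rw [← MulOpposite.op_mul, ← MulOpposite.op_mul]
      congr 1
      rw [neg_mul_neg, neg_mul_neg, mul_assoc, x_mul_Y, ← mul_assoc, ← mul_assoc, g_mul_Y])

/-- The antipode of `A_(α)`. -/
def antipodeMap : QuantumAlg k p α →ₗ[k] QuantumAlg k p α :=
  (MulOpposite.opLinearEquiv k).symm.toLinearMap ∘ₗ (antipodeHom k p α).toLinearMap

@[simp] theorem antipodeMap_one : antipodeMap k p α 1 = 1 := by simp [antipodeMap]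

@[simp] theorem antipodeMap_Y : antipodeMap k p α (Y k p α) = -Y k p α := by
  simp [antipodeMap, antipodeHom]

@[simp] theorem antipodeMap_g : antipodeMap k p α (g k p α) = g k p α := by
  simp [antipodeMap, antipodeHom]

@[simp] theorem antipodeMap_x : antipodeMap k p α (x k p α) = -(g k p α * x k p α) := by
  simp [antipodeMap, antipodeHom]

instance hopfAlgebra : HopfAlgebra k (QuantumAlg k p α) where
  antipode := antipodeMap k p α
  mul_antipode_rTensor_comul := by
    refine LinearMap.ext fun a => ?_
    simp only [LinearMap.comp_apply, Algebra.linearMap_apply]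
    induction a using QuantumAlg.induction with
    | algebraMap c =>
      rw [Algebra.algebraMap_eq_smul_one]
      simp [Algebra.TensorProduct.one_def, Algebra.algebraMap_eq_smul_one]
    | Y => simp
    | g => simp [g_mul_g]
    | x => simp
    | mul a b ha hb =>
      rw [Bialgebra.comul_mul]
      refine (mul'_rTensor_antipode_mul (antipodeHom k p α) _ _ _ ha).trans ?_
      refine (congrArg _ hb).trans ?_
      rw [Bialgebra.counit_mul, map_mul, Algebra.smul_def]
    | add a b ha hb => simp only [map_add, ha, hb]
  mul_antipode_lTensor_comul := by
    refine LinearMap.ext fun a => ?_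
    simp only [LinearMap.comp_apply, Algebra.linearMap_apply]
    induction a using QuantumAlg.induction with
    | algebraMap c =>
      rw [Algebra.algebraMap_eq_smul_one]
      simp [Algebra.TensorProduct.one_def, Algebra.algebraMap_eq_smul_one]
    | Y => simp
    | g => simp [g_mul_g]
    | x => simp [← mul_assoc, g_mul_g]
    | mul a b ha hb =>
      rw [Bialgebra.comul_mul]
      refine (mul'_lTensor_antipode_mul (antipodeHom k p α) _ _ _ hb).trans ?_
      refine (congrArg _ ha).trans ?_
      rw [Bialgebra.counit_mul, map_mul, Algebra.smul_def, Algebra.commutes]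
    | add a b ha hb => simp only [map_add, ha, hb]

end QuantumAlg

end

noncomputable section

/-! ### Non-isomorphism: nilpotency of `Y` in commutative quotients -/

namespace QuantumAlg

variable {k : Type*} [Field k] {p : ℕ} [CharP k p]

/-! Non-isomorphism is detected by maps to commutative algebras. Such a map kills `x`, because `xg =
-gx`, `g² = 1` and `2 ≠ 0`; on `A_(e_i)` it therefore kills `Y^(pⁱ)`. If it also sends `g` to `1`,
then additivity of Frobenius gives `φ(z)^(pⁱ) = ε(z)^(pⁱ)` for every `z`, not only for generators
(`map_pow_eq_counit_pow`). This bound on nilpotency refers only to `ε`, so it can be carried across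
an isomorphism without knowing where the generators go. For `i < j`, the quotient `k[Y]/(Y^(p^j))`
of `A_(e_j)` contains an element of counit zero, the class of `Y`, whose `pⁱ`-th power is nonzero.
This rules out an isomorphism with `A_(e_i)`.

For the crossed product, let `P = ∑ᵢ αᵢ Y^(pⁱ)`. The subalgebra `k[Y]` is central in `A_(α)`, so the
action can be trivial, and `A_(α)` is free over `k[Y]` on `1, g, x, gx`. The freeness is seen by
mapping to the quaternion algebra over `k[Y]` with `i² = 1`, `j² = P`. Hence `a ⊗ h ↦ a h` is a
bijection `k[Y] ⊗ H₄ → A_(α)`, and it respects the coalgebra structures. Only `x² = P` instead of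
`x² = 0` distinguishes the product from that of the tensor product algebra, and the cocycle records
this correction. The crossed system axioms are then pulled back from the Hopf algebra `A_(α)` along
the bijection (`CrossedSystem.ofCoalgEquiv`), so no cocycle identity has to be checked directly. -/

theorem two_ne_zero_of_three_le (k : Type*) [Field k] (p : ℕ) [CharP k p] (h3 : 3 ≤ p) :
    (2 : k) ≠ 0 := by
  intro h
  have h2 : p ∣ 2 := (CharP.cast_eq_zero_iff k p 2).1 (by exact_mod_cast h)
  exact absurd (Nat.le_of_dvd two_pos h2) (by omega)

/-- An algebra map from `A_(α)` to a commutative algebra kills `x`. -/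
theorem map_x_eq_zero (h3 : 3 ≤ p) {α : ℕ →₀ k} {B : Type*} [CommRing B] [Algebra k B]
    (φ : QuantumAlg k p α →ₐ[k] B) : φ (x k p α) = 0 := by
  have h := congrArg φ (x_mul_g k p α)
  have hg := congrArg φ (g_mul_g k p α)
  simp only [map_mul, map_neg, map_one] at h hg
  have h2 : (2 : k) • φ (x k p α) = 0 := by
    rw [Algebra.smul_def, map_ofNat]
    -- Multiplying `xg = -gx` by `g` in the commutative target gives `2g²x = 0`, and `g² = 1`.
    linear_combination φ (g k p α) * h - 2 * φ (x k p α) * hg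
  exact (smul_eq_zero.1 h2).resolve_left (two_ne_zero_of_three_le k p h3)

variable [hp : Fact p.Prime]

/-- Both sides are multiplicative in `z`, and additive since `p^i`-th powers are additive in
characteristic `p`; so scalars and generators suffice. For `Y`, the relation `x² = Y^(pⁱ)` and `φ(x)
= 0` give the claim. -/
theorem map_pow_eq_counit_pow (h3 : 3 ≤ p) {i : ℕ} {B : Type*} [CommRing B] [Algebra k B]
    (φ : QuantumAlg k p (Finsupp.single i 1) →ₐ[k] B)
    (hg : φ (g k p (Finsupp.single i 1)) = 1) (z : QuantumAlg k p (Finsupp.single i 1)) :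
    φ z ^ p ^ i = algebraMap k B (Coalgebra.counit (R := k) z) ^ p ^ i := by
  have hp0 : p ^ i ≠ 0 := pow_ne_zero _ hp.out.ne_zero
  have hx := map_x_eq_zero h3 φ
  induction z using QuantumAlg.induction with
  | algebraMap c => simp [Bialgebra.counit_algebraMap]
  | Y =>
    have h := congrArg φ (x_mul_x k p (Finsupp.single i 1))
    rw [map_mul, hx, Finsupp.sum_single_index (by simp)] at h
    simp only [one_smul, mul_zero, map_pow] at h
    rw [← h, counit_Y, map_zero, zero_pow hp0]
  | g => simp [hg]
  | x => simp [hx]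
  | mul a b ha hb => simp only [map_mul, mul_pow, ha, hb, Bialgebra.counit_mul]
  | add a b ha hb =>
    rw [map_add, map_add, map_add, add_pow_prime_pow k p (Commute.all (φ a) (φ b)), ha, hb,
      ← add_pow_prime_pow k p (Commute.all _ _)]

theorem isEmpty_bialgEquiv_of_lt (h3 : 3 ≤ p) {i j : ℕ} (hij : i < j) :
    IsEmpty (QuantumAlg k p (Finsupp.single i 1) ≃ₐc[k] QuantumAlg k p (Finsupp.single j 1)) := by
  refine ⟨fun e => ?_⟩
  set P : k[X] := Polynomial.X ^ p ^ j
  have hp0 : ∀ n, p ^ n ≠ 0 := fun n => pow_ne_zero _ hp.out.ne_zero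
  have hroot : AdjoinRoot.root P ^ p ^ j = 0 := by
    have h := AdjoinRoot.eval₂_root P
    simpa [P] using h
  -- The quotient by `g = 1`, `x = 0`: the relation for `x²` leaves exactly `Y^(p^j) = 0`.
  let φ : QuantumAlg k p (Finsupp.single j 1) →ₐ[k] AdjoinRoot P :=
    lift (AdjoinRoot.root P) 1 0 (by simp)
      (by rw [Finsupp.sum_single_index (by simp), hroot]; simp)
      (by simp) (by simp) (by simp)
  let ψ : QuantumAlg k p (Finsupp.single i 1) →ₐ[k] AdjoinRoot P :=
    φ.comp (e : QuantumAlg k p (Finsupp.single i 1) →ₐ[k] QuantumAlg k p (Finsupp.single j 1))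
  have hφg : φ (g k p (Finsupp.single j 1)) = 1 := lift_g _ _ _ _ _ _ _ _
  have hφY : φ (Y k p (Finsupp.single j 1)) = AdjoinRoot.root P := lift_Y _ _ _ _ _ _ _ _
  have hcounit : ∀ z, Coalgebra.counit (R := k) (e z) = Coalgebra.counit (R := k) z :=
    fun z => CoalgHomClass.counit_comp_apply e z
  -- No knowledge of `e(g)` is needed: the power lemma for `φ` at `e(g)` gives `ψ(g)^(p^j) = 1`.
  -- Since `ψ(g)² = 1` and `p^j` is odd, `ψ(g) = 1`.
  have hψg : ψ (g k p (Finsupp.single i 1)) = 1 := by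
    have h := map_pow_eq_counit_pow h3 φ hφg (e (g k p (Finsupp.single i 1)))
    rw [hcounit, counit_g, map_one, one_pow] at h
    have h2 := congrArg ψ (g_mul_g k p (Finsupp.single i 1))
    rw [map_mul, map_one, ← pow_two] at h2
    obtain ⟨m, hm⟩ : Odd (p ^ j) := (hp.out.odd_of_ne_two (by omega)).pow
    change ψ (g k p (Finsupp.single i 1)) ^ p ^ j = 1 at h
    rwa [hm, pow_succ, pow_mul, h2, one_pow, one_mul] at h
  -- Evaluated at the preimage of `Y`, which has counit zero, this says that the root has vanishing
  -- `pⁱ`-th power, so `X^(p^j)` divides `X^(pⁱ)`.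
  have h := map_pow_eq_counit_pow h3 ψ hψg (e.symm (Y k p (Finsupp.single j 1)))
  rw [← hcounit] at h
  change φ (e (e.symm _)) ^ _ = _ at h
  rw [BialgEquiv.apply_symm_apply, counit_Y, map_zero, zero_pow (hp0 i), hφY,
    ← AdjoinRoot.mk_X, ← map_pow, AdjoinRoot.mk_eq_zero] at h
  exact absurd ((pow_dvd_pow_iff Polynomial.X_ne_zero Polynomial.not_isUnit_X).1 h)
    (not_le.2 (Nat.pow_lt_pow_right hp.out.one_lt hij))

end QuantumAlg

/-! ### Transport of Hopf structure to a crossed product -/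

section Transport

variable {k A H Q : Type*} [Field k] [Ring A] [HopfAlgebra k A] [Ring H] [HopfAlgebra k H]
  [Ring Q] [HopfAlgebra k Q] (act : H →ₗ[k] A →ₗ[k] A) (f : H →ₗ[k] H →ₗ[k] A)
  (ψ : A ⊗[k] H ≃ₗc[k] Q)

variable {act f ψ} in
theorem map_map₂_crossedMul (hmul : ∀ u v, ψ (crossedMul act f u v) = ψ u * ψ v)
    (P R : (A ⊗[k] H) ⊗[k] (A ⊗[k] H)) :
    TensorProduct.map ψ.toLinearEquiv.toLinearMap ψ.toLinearEquiv.toLinearMap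
      (TensorProduct.map₂ (crossedMul act f) (crossedMul act f) P R) =
    TensorProduct.map ψ.toLinearEquiv.toLinearMap ψ.toLinearEquiv.toLinearMap P *
      TensorProduct.map ψ.toLinearEquiv.toLinearMap ψ.toLinearEquiv.toLinearMap R := by
  induction P using TensorProduct.induction_on with
  | zero => simp
  | add x y hx hy => simp only [map_add, add_mul, LinearMap.add_apply, hx, hy]
  | tmul a b =>
    induction R using TensorProduct.induction_on with
    | zero => simp
    | add x y hx hy => simp only [map_add, mul_add, hx, hy]
    | tmul c d => simp [hmul]

theorem map_coalgEquiv_comul (u : A ⊗[k] H) :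
    TensorProduct.map ψ.toLinearEquiv.toLinearMap ψ.toLinearEquiv.toLinearMap
      (Coalgebra.comul (R := k) u) = Coalgebra.comul (R := k) (ψ u) :=
  CoalgHomClass.map_comp_comul_apply ψ u

variable {act f ψ} in
-- Turns the two convolution identities for the antipode into the corresponding ones in `Q`.
theorem apply_lift_crossedMul (hmul : ∀ u v, ψ (crossedMul act f u v) = ψ u * ψ v)
    (w : (A ⊗[k] H) ⊗[k] (A ⊗[k] H)) :
    ψ (TensorProduct.lift (crossedMul act f) w) = LinearMap.mul' k Q
      (TensorProduct.map ψ.toLinearEquiv.toLinearMap ψ.toLinearEquiv.toLinearMap w) := by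
  induction w using TensorProduct.induction_on with
  | zero => simp
  | add x y hx hy => simp only [map_add, hx, hy]
  | tmul a b => simp [hmul]

/-- A coalgebra isomorphism `A ⊗ H ≃ Q` onto a Hopf algebra which turns the multiplication
`(a # h)(c # g) = a (h₁ ▷ c) f(h₂, g₁) # h₃ g₂` into that of `Q` gives a crossed system. -/
def CrossedSystem.ofCoalgEquiv
    (act_one : ∀ h : H, act h 1 = (Coalgebra.counit (R := k) h) • (1 : A))
    (one_act : ∀ a : A, act 1 a = a)
    (act_mul : ∀ (h : H) (a b : A), act h (a * b) =
      LinearMap.mul' k A (TensorProduct.map (act.flip a) (act.flip b) (Coalgebra.comul h)))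
    (hmul : ∀ u v, ψ (crossedMul act f u v) = ψ u * ψ v) (hone : ψ (1 ⊗ₜ[k] 1) = 1) :
    CrossedSystem k A H where
  act := act
  cocycle := f
  act_one := act_one
  one_act := one_act
  act_mul := act_mul
  mul_assoc u v w := (EquivLike.injective ψ) (by simp only [hmul, _root_.mul_assoc])
  one_mul u := (EquivLike.injective ψ) (by rw [hmul, hone, _root_.one_mul])
  mul_one u := (EquivLike.injective ψ) (by rw [hmul, hone, _root_.mul_one])
  counit_mul u v := by
    have h := fun w => CoalgHomClass.counit_comp_apply ψ w
    rw [← h, hmul, Bialgebra.counit_mul, h, h]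
  comul_mul u v := by
    apply (TensorProduct.congr ψ.toLinearEquiv ψ.toLinearEquiv).injective
    refine (map_coalgEquiv_comul ψ _).trans (Eq.trans ?_ (map_map₂_crossedMul hmul _ _).symm)
    rw [map_coalgEquiv_comul, map_coalgEquiv_comul, hmul, Bialgebra.comul_mul]
  exists_antipode := by
    -- The antipode of `Q` conjugated by `ψ`; `h1` and `h2` move `ψ ⊗ ψ` past it.
    refine ⟨ψ.symm.toLinearEquiv.toLinearMap ∘ₗ HopfAlgebra.antipode k ∘ₗ
      ψ.toLinearEquiv.toLinearMap, fun u => ?_⟩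
    have h1 : TensorProduct.map ψ.toLinearEquiv.toLinearMap ψ.toLinearEquiv.toLinearMap ∘ₗ
        (ψ.symm.toLinearEquiv.toLinearMap ∘ₗ HopfAlgebra.antipode k ∘ₗ
          ψ.toLinearEquiv.toLinearMap).rTensor (A ⊗[k] H) =
        (HopfAlgebra.antipode k).rTensor Q ∘ₗ
          TensorProduct.map ψ.toLinearEquiv.toLinearMap ψ.toLinearEquiv.toLinearMap := by
      apply TensorProduct.ext'
      intro a b
      simp
    have h2 : TensorProduct.map ψ.toLinearEquiv.toLinearMap ψ.toLinearEquiv.toLinearMap ∘ₗ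
        (ψ.symm.toLinearEquiv.toLinearMap ∘ₗ HopfAlgebra.antipode k ∘ₗ
          ψ.toLinearEquiv.toLinearMap).lTensor (A ⊗[k] H) =
        (HopfAlgebra.antipode k).lTensor Q ∘ₗ
          TensorProduct.map ψ.toLinearEquiv.toLinearMap ψ.toLinearEquiv.toLinearMap := by
      apply TensorProduct.ext'
      intro a b
      simp
    have hε : ψ (Coalgebra.counit (R := k) u • ((1 : A) ⊗ₜ[k] (1 : H))) =
        algebraMap k Q (Coalgebra.counit (R := k) (ψ u)) := by
      rw [map_smul, hone, Algebra.algebraMap_eq_smul_one, CoalgHomClass.counit_comp_apply ψ u]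
    constructor <;> apply EquivLike.injective ψ <;> rw [apply_lift_crossedMul hmul, hε]
    · rw [← LinearMap.comp_apply (TensorProduct.map _ _), h1, LinearMap.comp_apply,
        map_coalgEquiv_comul, HopfAlgebra.mul_antipode_rTensor_comul_apply]
    · rw [← LinearMap.comp_apply (TensorProduct.map _ _), h2, LinearMap.comp_apply,
        map_coalgEquiv_comul, HopfAlgebra.mul_antipode_lTensor_comul_apply]

/-- The crossed product of `CrossedSystem.ofCoalgEquiv` is the given Hopf algebra. -/
def CrossedSystem.ofCoalgEquivBialgEquiv
    (act_one : ∀ h : H, act h 1 = (Coalgebra.counit (R := k) h) • (1 : A))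
    (one_act : ∀ a : A, act 1 a = a)
    (act_mul : ∀ (h : H) (a b : A), act h (a * b) =
      LinearMap.mul' k A (TensorProduct.map (act.flip a) (act.flip b) (Coalgebra.comul h)))
    (hmul : ∀ u v, ψ (crossedMul act f u v) = ψ u * ψ v) (hone : ψ (1 ⊗ₜ[k] 1) = 1) :
    CrossedProduct (CrossedSystem.ofCoalgEquiv act f ψ act_one one_act act_mul hmul hone)
      ≃ₐc[k] Q :=
  { (ψ : A ⊗[k] H ≃ₗc[k] Q) with
    map_mul' := hmul }

end Transport

/-! ### Crossed products with trivial action -/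

section TrivialAction

variable {k A H : Type*} [Field k] [Ring A] [HopfAlgebra k A] [Ring H] [HopfAlgebra k H]

variable (k A H) in
/-- The trivial action `h ▷ a = ε(h) a`. -/
def trivialAct : H →ₗ[k] A →ₗ[k] A :=
  (Coalgebra.counit (R := k) (A := H)).smulRight LinearMap.id

@[simp] theorem trivialAct_apply (h : H) (a : A) :
    trivialAct k A H h a = Coalgebra.counit (R := k) h • a := rfl

theorem trivialAct_mul (h : H) (a b : A) : trivialAct k A H h (a * b) =
    LinearMap.mul' k A (TensorProduct.map ((trivialAct k A H).flip a) ((trivialAct k A H).flip b)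
      (Coalgebra.comul h)) := by
  -- An arbitrary tensor replaces `Δ(h)` to allow induction on pure tensors; the counit axiom is
  -- applied afterwards.
  have key : ∀ w : H ⊗[k] H, LinearMap.mul' k A (TensorProduct.map ((trivialAct k A H).flip a)
      ((trivialAct k A H).flip b) w) = Coalgebra.counit (R := k)
        (TensorProduct.lid k H ((Coalgebra.counit (R := k)).rTensor H w)) • (a * b) := by
    intro w
    induction w using TensorProduct.induction_on with
    | zero => simp
    | add u v hu hv => simp only [map_add, add_smul, hu, hv]
    | tmul u v => simp [smul_smul, mul_comm]
  rw [key, Coalgebra.rTensor_counit_comul]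
  simp

/-- Since `h₁ ▷ c = ε(h₁) c`, the counit axiom absorbs one comultiplication of `h`, leaving only the
cocycle part. -/
theorem crossedActMul_trivialAct (f : H →ₗ[k] H →ₗ[k] A) (h l : H) (c : A) :
    crossedActMul (trivialAct k A H) f (h ⊗ₜ[k] (c ⊗ₜ[k] l)) =
      crossedLeftMul k A H (c ⊗ₜ[k] crossedCocycleMul f (h ⊗ₜ[k] l)) := by
  have key : ∀ w : H ⊗[k] H, crossedLeftMul k A H
      (TensorProduct.map (TensorProduct.lift (trivialAct k A H)) (crossedCocycleMul f)
        (TensorProduct.tensorTensorTensorComm k H H A H (w ⊗ₜ[k] (c ⊗ₜ[k] l)))) =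
      crossedLeftMul k A H (c ⊗ₜ[k] crossedCocycleMul f
        (TensorProduct.lid k H ((Coalgebra.counit (R := k)).rTensor H w) ⊗ₜ[k] l)) := by
    intro w
    induction w using TensorProduct.induction_on with
    | zero => simp
    | add u v hu hv =>
      simp only [map_add, TensorProduct.add_tmul, TensorProduct.tmul_add, hu, hv]
    | tmul u v =>
      simp only [TensorProduct.tensorTensorTensorComm_tmul, TensorProduct.map_tmul,
        TensorProduct.lift.tmul, trivialAct_apply, LinearMap.rTensor_tmul, TensorProduct.lid_tmul,
        ← TensorProduct.smul_tmul', TensorProduct.tmul_smul, map_smul]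
  have h1 := key (Coalgebra.comul h)
  rw [Coalgebra.rTensor_counit_comul, TensorProduct.lid_tmul, one_smul] at h1
  exact h1

end TrivialAction

/-! ### The cocycle on Sweedler's algebra -/

namespace SweedlerH4

variable (k : Type*) [Field k]

theorem linearMap_ext {k : Type*} [Field k] {M : Type*} [AddCommGroup M] [Module k M]
    {φ ψ : SweedlerH4 k →ₗ[k] M} (h1 : φ 1 = ψ 1) (hg : φ (g k) = ψ (g k))
    (hx : φ (x k) = ψ (x k)) (hgx : φ (g k * x k) = ψ (g k * x k)) : φ = ψ := by
  refine LinearMap.ext fun a => ?_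
  rw [eq_smul k a]
  simp only [map_add, map_smul, h1, hg, hx, hgx]

theorem comul_g_mul_x : Coalgebra.comul (R := k) (g k * x k) =
    (g k * x k) ⊗ₜ[k] g k + 1 ⊗ₜ[k] (g k * x k) := by
  rw [Bialgebra.comul_mul, comul_g, comul_x]
  simp [mul_add, g_mul_g]

theorem counit_g_mul_x : Coalgebra.counit (R := k) (g k * x k) = 0 := by
  simp [Bialgebra.counit_mul]

/-- The cocycle `f(a, b) = ε(a) ε(b) + β(a, b) P` where `β` vanishes when one argument is `1` or
`g`, and `β(x, x) = β(gx, x) = 1`, `β(x, gx) = β(gx, gx) = -1`. -/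
def cocycle (P : k[X]) : SweedlerH4 k →ₗ[k] SweedlerH4 k →ₗ[k] k[X] :=
  -- The signs come from `x·x = P`, `gx·x = Pg`, `x·gx = -Pg` and `gx·gx = -P` in `A_(α)`, where `P
  -- = x²` is central. The remaining factor `1` or `g` is supplied by `h₂ g₂`.
  LinearMap.mk₂ k (fun a b => (Coalgebra.counit (R := k) a * Coalgebra.counit (R := k) b) • 1 +
    ((a.imJ + a.imK) * (b.imJ - b.imK)) • P)
    (by intros; simp [add_mul, add_smul]; abel)
    (by
      intros
      simp [smul_smul, mul_assoc]
      ring_nf)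
    (by intros; simp [mul_add, mul_sub, add_mul, sub_smul, add_smul]; abel)
    (by
      intros
      simp [smul_smul, mul_sub]
      ring_nf)

theorem cocycle_apply (P : k[X]) (a b : SweedlerH4 k) : cocycle k P a b =
    (Coalgebra.counit (R := k) a * Coalgebra.counit (R := k) b) • 1 +
      ((a.imJ + a.imK) * (b.imJ - b.imK)) • P := rfl

end SweedlerH4

/-! ### Freeness of `A_(α)` over `k[Y]` -/

namespace QuantumAlg

variable (k : Type*) [Field k] (p : ℕ) (α : ℕ →₀ k)

/-- The polynomial `∑ᵢ αᵢ Y^(pⁱ)`. -/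
def squarePoly : k[X] := α.sum fun i c => c • Polynomial.X ^ p ^ i

/-- The inclusion of `k[Y]`. -/
abbrev polyHom : k[X] →ₐ[k] QuantumAlg k p α := Polynomial.aeval (Y k p α)

theorem map_squarePoly {B : Type*} [Ring B] [Algebra k B] (φ : k[X] →ₐ[k] B) :
    φ (squarePoly k p α) = α.sum fun i c => c • φ Polynomial.X ^ p ^ i := by
  rw [squarePoly, map_finsuppSum]
  simp

theorem polyHom_squarePoly : polyHom k p α (squarePoly k p α) = x k p α * x k p α := by
  rw [x_mul_x, map_squarePoly, Polynomial.aeval_X]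

theorem commute_Y (z : QuantumAlg k p α) : Commute (Y k p α) z := by
  induction z using QuantumAlg.induction with
  | algebraMap c => exact (Algebra.commutes c _).symm
  | Y => exact Commute.refl _
  | g => exact (g_mul_Y k p α).symm
  | x => exact (x_mul_Y k p α).symm
  | mul a b ha hb => exact ha.mul_right hb
  | add a b ha hb => exact ha.add_right hb

/-- Centrality of `k[Y]`, which is what permits the trivial action. -/
theorem mul_polyHom (a : k[X]) (z : QuantumAlg k p α) :
    z * polyHom k p α a = polyHom k p α a * z := by
  induction a using Polynomial.induction_on' with
  | add a b ha hb => simp only [map_add, mul_add, add_mul, ha, hb]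
  | monomial n c =>
    rw [Polynomial.aeval_monomial, ← mul_assoc, ← Algebra.commutes c z, mul_assoc, mul_assoc,
      ((commute_Y k p α z).pow_left n).eq]

/-- The linear map `H₄ → A_(α)` with `1 ↦ 1`, `g ↦ g`, `x ↦ x`, `gx ↦ gx`. -/
def sweedlerMap : SweedlerH4 k →ₗ[k] QuantumAlg k p α where
  toFun a := a.re • 1 + a.imI • g k p α + a.imJ • x k p α + a.imK • (g k p α * x k p α)
  map_add' a b := by
    simp only [QuaternionAlgebra.re_add, QuaternionAlgebra.imI_add, QuaternionAlgebra.imJ_add,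
      QuaternionAlgebra.imK_add, add_smul]
    abel
  map_smul' c a := by simp [smul_smul]

theorem sweedlerMap_apply (a : SweedlerH4 k) : sweedlerMap k p α a =
    a.re • 1 + a.imI • g k p α + a.imJ • x k p α + a.imK • (g k p α * x k p α) := rfl

@[simp] theorem sweedlerMap_one : sweedlerMap k p α 1 = 1 := by simp [sweedlerMap_apply]

@[simp] theorem sweedlerMap_g : sweedlerMap k p α (SweedlerH4.g k) = g k p α := by
  simp [sweedlerMap_apply, SweedlerH4.g]

@[simp] theorem sweedlerMap_x : sweedlerMap k p α (SweedlerH4.x k) = x k p α := by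
  simp [sweedlerMap_apply, SweedlerH4.x]

@[simp] theorem sweedlerMap_g_mul_x :
    sweedlerMap k p α (SweedlerH4.g k * SweedlerH4.x k) = g k p α * x k p α := by
  simp [sweedlerMap_apply, SweedlerH4.g_mul_x]

/-- The linear map `k[Y] ⊗ H₄ → A_(α)`, `a ⊗ h ↦ a h`. -/
def tensorMap : k[X] ⊗[k] SweedlerH4 k →ₗ[k] QuantumAlg k p α :=
  LinearMap.mul' k _ ∘ₗ TensorProduct.map (polyHom k p α).toLinearMap (sweedlerMap k p α)

@[simp] theorem tensorMap_tmul (a : k[X]) (h : SweedlerH4 k) :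
    tensorMap k p α (a ⊗ₜ[k] h) = polyHom k p α a * sweedlerMap k p α h := rfl

/-- The algebra map from `A_(α)` to the quaternion algebra over `k[Y]` with `i² = 1`,
`j² = ∑ᵢ αᵢ Y^(pⁱ)`. -/
def toQuaternion : QuantumAlg k p α →ₐ[k] ℍ[k[X], 1, 0, squarePoly k p α] :=
  lift (algebraMap k[X] _ Polynomial.X) ⟨0, 1, 0, 0⟩ ⟨0, 0, 1, 0⟩
    (by ext <;> simp)
    (by
      -- Writing `j²` as the image of `P` under a `k`-algebra map lets `map_squarePoly` expand it
      -- into powers of `Y`.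
      have h : (⟨0, 0, 1, 0⟩ : ℍ[k[X], 1, 0, squarePoly k p α]) * ⟨0, 0, 1, 0⟩ =
          (IsScalarTower.toAlgHom k k[X] ℍ[k[X], 1, 0, squarePoly k p α])
            (squarePoly k p α) := by
        ext1 <;> simp [QuaternionAlgebra.algebraMap_eq]
      rw [h, map_squarePoly]
      rfl)
    (by ext <;> simp)
    (Algebra.commutes _ _).symm
    (Algebra.commutes _ _).symm

theorem toQuaternion_polyHom (a : k[X]) :
    toQuaternion k p α (polyHom k p α a) = algebraMap k[X] _ a := by
  have h : (toQuaternion k p α).comp (polyHom k p α) = IsScalarTower.toAlgHom k k[X] _ := by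
    apply Polynomial.algHom_ext
    simp [toQuaternion]
  exact DFunLike.congr_fun h a

theorem toQuaternion_sweedlerMap (h : SweedlerH4 k) :
    toQuaternion k p α (sweedlerMap k p α h) =
      ⟨algebraMap k _ h.re, algebraMap k _ h.imI, algebraMap k _ h.imJ, algebraMap k _ h.imK⟩ := by
  simp only [sweedlerMap_apply, map_add, map_smul, map_mul, map_one]
  simp only [toQuaternion, lift_g, lift_x]
  ext1 <;> simp [Polynomial.smul_eq_C_mul]

/-- The linear map sending `a + bi + cj + dij` to `a ⊗ 1 + b ⊗ g + c ⊗ x + d ⊗ gx`. -/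
def ofQuaternion (P : k[X]) : ℍ[k[X], 1, 0, P] →ₗ[k] k[X] ⊗[k] SweedlerH4 k where
  toFun u := u.re ⊗ₜ[k] 1 + u.imI ⊗ₜ[k] SweedlerH4.g k + u.imJ ⊗ₜ[k] SweedlerH4.x k +
    u.imK ⊗ₜ[k] (SweedlerH4.g k * SweedlerH4.x k)
  map_add' u v := by
    simp only [QuaternionAlgebra.re_add, QuaternionAlgebra.imI_add, QuaternionAlgebra.imJ_add,
      QuaternionAlgebra.imK_add, TensorProduct.add_tmul]
    abel
  map_smul' c u := by simp [TensorProduct.smul_tmul']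

/-- The images of `1, g, x, gx` are the quaternion basis, so reading off quaternion coordinates
gives a left inverse. -/
theorem tensorMap_injective : Function.Injective (tensorMap k p α) := by
  have h : ofQuaternion k _ ∘ₗ (toQuaternion k p α).toLinearMap ∘ₗ tensorMap k p α =
      LinearMap.id := by
    apply TensorProduct.ext'
    intro a h
    conv_rhs => rw [SweedlerH4.eq_smul k h]
    simp only [LinearMap.comp_apply, tensorMap_tmul, AlgHom.toLinearMap_apply, map_mul,
      toQuaternion_polyHom, toQuaternion_sweedlerMap]
    rw [← Algebra.smul_def]
    simp [ofQuaternion, Polynomial.smul_eq_C_mul, mul_comm a, TensorProduct.tmul_add,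
      TensorProduct.smul_tmul']
  exact Function.LeftInverse.injective (g := ofQuaternion k _ ∘ₗ (toQuaternion k p α).toLinearMap)
    (DFunLike.congr_fun h)

theorem tensorMap_crossedLeftMul (a : k[X]) (t : k[X] ⊗[k] SweedlerH4 k) :
    tensorMap k p α (crossedLeftMul k _ _ (a ⊗ₜ[k] t)) = polyHom k p α a * tensorMap k p α t := by
  induction t using TensorProduct.induction_on with
  | zero => simp
  | add u v hu hv => simp only [TensorProduct.tmul_add, map_add, mul_add, hu, hv]
  | tmul b h => simp [crossedLeftMul, mul_assoc]

end QuantumAlg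

/-- Applied to `Δ(a)` and `Δ(h)`, this identifies the image of the comultiplication of `a ⊗ h` with
a product of two comultiplications in `Q ⊗ Q`. -/
theorem TensorProduct.map_mul'_map_tensorTensorTensorComm {k A H Q : Type*} [Field k]
    [AddCommGroup A] [Module k A] [AddCommGroup H] [Module k H] [Ring Q] [Algebra k Q]
    (φ : A →ₗ[k] Q) (σ : H →ₗ[k] Q) (w : A ⊗[k] A) (v : H ⊗[k] H) :
    TensorProduct.map (LinearMap.mul' k Q ∘ₗ TensorProduct.map φ σ)
      (LinearMap.mul' k Q ∘ₗ TensorProduct.map φ σ)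
      (TensorProduct.AlgebraTensorModule.tensorTensorTensorComm k k k k A A H H (w ⊗ₜ[k] v)) =
    TensorProduct.map φ φ w * TensorProduct.map σ σ v := by
  induction w using TensorProduct.induction_on with
  | zero => simp
  | add x y hx hy => simp only [TensorProduct.add_tmul, map_add, add_mul, hx, hy]
  | tmul a b =>
    induction v using TensorProduct.induction_on with
    | zero => simp
    | add x y hx hy => simp only [TensorProduct.tmul_add, map_add, mul_add, hx, hy]
    | tmul c d => simp

/-! ### Compatibility of `k[Y] ⊗ H₄ ≃ A_(α)` with products and coproducts -/

namespace QuantumAlg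

variable (k : Type*) [Field k] (p : ℕ) (α : ℕ →₀ k)

/-- Bilinearity reduces this to the sixteen pairs from `1, g, x, gx`, where the cocycle restores the
terms that `x² = 0` removes in `H₄`. -/
theorem tensorMap_crossedCocycleMul (h l : SweedlerH4 k) :
    tensorMap k p α (crossedCocycleMul (SweedlerH4.cocycle k (squarePoly k p α)) (h ⊗ₜ[k] l)) =
      sweedlerMap k p α h * sweedlerMap k p α l := by
  have hxx := polyHom_squarePoly k p α
  have hgP := mul_polyHom k p α (squarePoly k p α) (g k p α)
  rw [hxx] at hgP
  have hxg := x_mul_g k p α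
  have hgg := g_mul_g k p α
  -- The relations in a form usable inside right-associated words, so that `simp` moves each `g`
  -- left and cancels `g²`.
  have hggz : ∀ z, g k p α * (g k p α * z) = z := fun z => by rw [← mul_assoc, hgg, one_mul]
  have hxgz : ∀ z, x k p α * (g k p α * z) = -(g k p α * (x k p α * z)) := fun z => by
    rw [← mul_assoc, hxg, neg_mul, mul_assoc]
  have key : TensorProduct.curry (tensorMap k p α ∘ₗ
      crossedCocycleMul (SweedlerH4.cocycle k (squarePoly k p α))) =
      (LinearMap.mul k (QuantumAlg k p α)).compl₁₂ (sweedlerMap k p α) (sweedlerMap k p α) := by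
    apply SweedlerH4.linearMap_ext <;> apply SweedlerH4.linearMap_ext <;>
    · simp only [TensorProduct.curry_apply, LinearMap.comp_apply, crossedCocycleMul,
        TensorProduct.comul_tmul, SweedlerH4.comul_g, SweedlerH4.comul_x,
        SweedlerH4.comul_g_mul_x, Bialgebra.comul_one, Algebra.TensorProduct.one_def,
        TensorProduct.add_tmul, TensorProduct.tmul_add, map_add,
        TensorProduct.AlgebraTensorModule.tensorTensorTensorComm_tmul, TensorProduct.map_tmul,
        TensorProduct.lift.tmul, LinearMap.mul'_apply, tensorMap_tmul,
        SweedlerH4.cocycle_apply, LinearMap.compl₁₂_apply, LinearMap.mul_apply',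
        SweedlerH4.counit_g, SweedlerH4.counit_x, SweedlerH4.counit_g_mul_x,
        Bialgebra.counit_one, sweedlerMap_one, sweedlerMap_g, sweedlerMap_x,
        sweedlerMap_g_mul_x]
      simp [SweedlerH4.g, SweedlerH4.x, sweedlerMap_apply, hxx, hxg, hgg,
        hggz, hxgz, mul_assoc]
  exact LinearMap.congr_fun (LinearMap.congr_fun key h) l

theorem tensorMap_crossedMul (u v : k[X] ⊗[k] SweedlerH4 k) :
    tensorMap k p α (crossedMul (trivialAct k _ _) (SweedlerH4.cocycle k (squarePoly k p α)) u v) =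
      tensorMap k p α u * tensorMap k p α v := by
  induction u using TensorProduct.induction_on with
  | zero => simp
  | add x y hx hy => simp only [map_add, add_mul, LinearMap.add_apply, hx, hy]
  | tmul a h =>
    induction v using TensorProduct.induction_on with
    | zero => simp
    | add x y hx hy => simp only [map_add, mul_add, hx, hy]
    | tmul c l =>
      simp only [crossedMul, TensorProduct.curry_apply, LinearMap.comp_apply,
        LinearEquiv.coe_coe, TensorProduct.assoc_tmul, LinearMap.lTensor_tmul,
        crossedActMul_trivialAct, tensorMap_crossedLeftMul, tensorMap_crossedCocycleMul,
        tensorMap_tmul]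
      -- Centrality of `k[Y]` moves `c` to the left past `h`.
      rw [mul_assoc (polyHom k p α a) (sweedlerMap k p α h), ← mul_assoc (sweedlerMap k p α h),
        mul_polyHom, mul_assoc (polyHom k p α c)]

/-- The range contains the scalars and generators, and `tensorMap_crossedMul` makes it closed under
products; no separate spanning argument is needed. -/
theorem tensorMap_surjective : Function.Surjective (tensorMap k p α) := by
  intro z
  induction z using QuantumAlg.induction with
  | algebraMap c => exact ⟨Polynomial.C c ⊗ₜ 1, by simp⟩
  | Y => exact ⟨Polynomial.X ⊗ₜ 1, by simp⟩
  | g => exact ⟨1 ⊗ₜ SweedlerH4.g k, by simp⟩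
  | x => exact ⟨1 ⊗ₜ SweedlerH4.x k, by simp⟩
  | mul a b ha hb =>
    obtain ⟨u, rfl⟩ := ha
    obtain ⟨v, rfl⟩ := hb
    exact ⟨_, tensorMap_crossedMul k p α u v⟩
  | add a b ha hb =>
    obtain ⟨u, rfl⟩ := ha
    obtain ⟨v, rfl⟩ := hb
    exact ⟨u + v, map_add _ _ _⟩

variable [hp : Fact p.Prime] [CharP k p]

theorem comul_polyHom (a : k[X]) : Coalgebra.comul (R := k) (polyHom k p α a) =
    Algebra.TensorProduct.map (polyHom k p α) (polyHom k p α) (Coalgebra.comul (R := k) a) := by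
  have h : (Bialgebra.comulAlgHom k (QuantumAlg k p α)).comp (polyHom k p α) =
      (Algebra.TensorProduct.map (polyHom k p α) (polyHom k p α)).comp
        (Bialgebra.comulAlgHom k k[X]) := by
    apply Polynomial.algHom_ext
    simp
  exact DFunLike.congr_fun h a

theorem counit_polyHom (a : k[X]) : Coalgebra.counit (R := k) (polyHom k p α a) =
    Coalgebra.counit (R := k) a := by
  have h : (Bialgebra.counitAlgHom k (QuantumAlg k p α)).comp (polyHom k p α) =
      Bialgebra.counitAlgHom k k[X] := by
    apply Polynomial.algHom_ext
    simp
  exact DFunLike.congr_fun h a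

theorem comul_sweedlerMap (a : SweedlerH4 k) : Coalgebra.comul (R := k) (sweedlerMap k p α a) =
    TensorProduct.map (sweedlerMap k p α) (sweedlerMap k p α) (Coalgebra.comul (R := k) a) := by
  have h : Coalgebra.comul ∘ₗ sweedlerMap k p α =
      TensorProduct.map (sweedlerMap k p α) (sweedlerMap k p α) ∘ₗ Coalgebra.comul := by
    apply SweedlerH4.linearMap_ext
    · simp [Algebra.TensorProduct.one_def]
    · simp
    · simp
    · rw [LinearMap.comp_apply, LinearMap.comp_apply, SweedlerH4.comul_g_mul_x,
        sweedlerMap_g_mul_x, Bialgebra.comul_mul, comul_g, comul_x]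
      simp [mul_add, g_mul_g]
  exact LinearMap.congr_fun h a

theorem counit_sweedlerMap (a : SweedlerH4 k) : Coalgebra.counit (R := k) (sweedlerMap k p α a) =
    Coalgebra.counit (R := k) a := by
  have h : Coalgebra.counit ∘ₗ sweedlerMap k p α = Coalgebra.counit (R := k) := by
    apply SweedlerH4.linearMap_ext <;> simp [Bialgebra.counit_mul]
  exact LinearMap.congr_fun h a

/-- The isomorphism of coalgebras `k[Y] ⊗ H₄ ≃ A_(α)`. -/
def tensorEquiv : k[X] ⊗[k] SweedlerH4 k ≃ₗc[k] QuantumAlg k p α :=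
  { LinearEquiv.ofBijective (tensorMap k p α)
      ⟨tensorMap_injective k p α, tensorMap_surjective k p α⟩ with
    counit_comp := by
      apply TensorProduct.ext'
      intro a h
      change Coalgebra.counit (R := k) (polyHom k p α a * sweedlerMap k p α h) = _
      rw [Bialgebra.counit_mul, counit_polyHom, counit_sweedlerMap]
      simp [mul_comm]
    map_comp_comul := by
      apply TensorProduct.ext'
      intro a h
      refine (TensorProduct.map_mul'_map_tensorTensorTensorComm (polyHom k p α).toLinearMap
        (sweedlerMap k p α) (Coalgebra.comul a) (Coalgebra.comul h)).trans ?_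
      change _ = Coalgebra.comul (R := k) (polyHom k p α a * sweedlerMap k p α h)
      rw [Bialgebra.comul_mul, comul_polyHom, comul_sweedlerMap]
      rfl }

/-- The crossed system with trivial action whose crossed product is `A_(α)`. -/
def crossedSystem : CrossedSystem k k[X] (SweedlerH4 k) :=
  CrossedSystem.ofCoalgEquiv (trivialAct k _ _) (SweedlerH4.cocycle k (squarePoly k p α))
    (tensorEquiv k p α) (fun _ => rfl) (fun a => by simp) trivialAct_mul
    (tensorMap_crossedMul k p α) (by change tensorMap k p α _ = 1; simp)

/-- `A_(α)` is a crossed product `k[Y] # H₄`. -/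
def crossedProductEquiv : CrossedProduct (crossedSystem k p α) ≃ₐc[k] QuantumAlg k p α :=
  CrossedSystem.ofCoalgEquivBialgEquiv _ _ _ _ _ _ _ _

end QuantumAlg

end

/-! ### Conclusion -/

theorem mainTheorem12 (k : Type*) [Field k] (p : ℕ) [Fact p.Prime] [CharP k p] (hp : 3 ≤ p) :
    (∀ i j : ℕ, i ≠ j →
      IsEmpty (QuantumAlg k p (Finsupp.single i 1) ≃ₐc[k] QuantumAlg k p (Finsupp.single j 1))) ∧
    (∀ j : ℕ, ∃ S : CrossedSystem k k[X] (SweedlerH4 k),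
      Nonempty (QuantumAlg k p (Finsupp.single j 1) ≃ₐc[k] CrossedProduct S)) ∧
    Infinite (Crp k (SweedlerH4 k) k[X]) := by
  have h1 : ∀ i j : ℕ, i ≠ j → IsEmpty
      (QuantumAlg k p (Finsupp.single i 1) ≃ₐc[k] QuantumAlg k p (Finsupp.single j 1)) := by
    intro i j hij
    rcases hij.lt_or_gt with h | h
    · exact QuantumAlg.isEmpty_bialgEquiv_of_lt hp h
    · exact ⟨fun e => (QuantumAlg.isEmpty_bialgEquiv_of_lt hp h).false e.symm⟩
  refine ⟨h1, fun j => ⟨_, ⟨(QuantumAlg.crossedProductEquiv k p _).symm⟩⟩,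
    Infinite.of_injective (fun j : ℕ => (Quotient.mk (crpSetoid k k[X] (SweedlerH4 k))
      (QuantumAlg.crossedSystem k p (Finsupp.single j 1)) : Crp k (SweedlerH4 k) k[X])) ?_⟩
  -- Equal classes in `Crp` give isomorphic crossed products, hence an isomorphism between `A_(e_i)`
  -- and `A_(e_j)`.
  intro i j hij
  by_contra hne
  obtain ⟨e⟩ : Nonempty (CrossedProduct (QuantumAlg.crossedSystem k p (Finsupp.single i 1)) ≃ₐc[k]
    CrossedProduct (QuantumAlg.crossedSystem k p (Finsupp.single j 1))) := Quotient.exact hij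
  exact (h1 i j hne).false (((QuantumAlg.crossedProductEquiv k p _).symm.trans e).trans
    (QuantumAlg.crossedProductEquiv k p _))
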